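/- Let $d\ge 1$ and let $\rho=\rho_{AB}$ be a state (density matrix) on $\mathbb C^d\otimes\mathbb C^d$, with reduced states $\rho_A=\mathrm{Tr}_B\,\rho$ and $\rho_B=\mathrm{Tr}_A\,\rho$. For POVMs $M=(M_x)_{x}$ on the first factor and $N=(N_y)_{y}$ on the second factor, each with finitely many outcomes, let $p_{AB}(x,y)=\mathrm{Tr}\big(\rho\,(M_x\otimes N_y)\big)$, with marginals $p_A,p_B$, and let $I(A{:}B)=H(p_A)+H(p_B)-H(p_{AB})$, where $H(p)=-\sum_a p(a)\log_2 p(a)$. Let $I_c(\rho)=\sup_{M,N} I(A{:}B)$ be the classical mutual information of $\rho$. Write $\mathrm{Tr}|X|$ for the trace norm, $|X|=\sqrt{X^\dagger X}$. Then: 1. $I_c(\rho)$ is finite, i.e. the supremum is taken over a set bounded above. 2. The least prime power $d'$ with $d'\ge d$ (where $1=p^0$ is counted as a prime power) satisfies $d'<2d$, and $$\mathrm{Tr}\,|\rho_{AB}-\rho_A\otimes\rho_B|\;\le\;(d'+1)^2\sqrt{2\ln 2\; I_c(\rho)} .$$ 3. In particular $$\mathrm{Tr}\,|\rho_{AB}-\rho_A\otimes\rho_B|\;\le\;(2d)^2\sqrt{2\ln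 2\; I_c(\rho)} .$$ 4. $I_c(\rho)=0$ if and only if $\rho$ is a product state, i.e. $\rho=\sigma\otimes\tau$ for some states $\sigma,\tau$ on $\mathbb C^d$. -/

import Mathlib

open Matrix
open scoped ComplexOrder MatrixOrder Kronecker

noncomputable section

/-- Operators on `ℂ^d ⊗ ℂ^d`, as matrices in the standard product basis. -/
abbrev BipartiteOp (d : ℕ) : Type := Matrix (Fin d × Fin d) (Fin d × Fin d) ℂ

/-- A quantum state (density matrix). -/
def IsState {ι : Type*} [Fintype ι] (ρ : Matrix ι ι ℂ) : Prop :=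
  ρ.PosSemidef ∧ ρ.trace = 1

/-- The reduced operator on the first factor, `ρ_A = Tr_B ρ`. -/
def reducedA {d : ℕ} (ρ : BipartiteOp d) : Matrix (Fin d) (Fin d) ℂ :=
  Matrix.of fun i j => ∑ k, ρ (i, k) (j, k)

/-- The reduced operator on the second factor, `ρ_B = Tr_A ρ`. -/
def reducedB {d : ℕ} (ρ : BipartiteOp d) : Matrix (Fin d) (Fin d) ℂ :=
  Matrix.of fun i j => ∑ k, ρ (k, i) (k, j)

/-- The trace norm `Tr |X|` with `|X| = √(X† X)`. -/
def traceNorm {ι : Type*} [Fintype ι] [DecidableEq ι] (X : Matrix ι ι ℂ) : ℝ :=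
  (CFC.abs X).trace.re

/-- A product state: a tensor product of two states. -/
def IsProductState {d : ℕ} (ρ : BipartiteOp d) : Prop :=
  ∃ σ τ : Matrix (Fin d) (Fin d) ℂ, IsState σ ∧ IsState τ ∧ ρ = σ ⊗ₖ τ

/-- A measurement (POVM) on `ℂ^d` with `m` outcomes. -/
structure Measurement (d m : ℕ) where
  /-- the effects -/
  effect : Fin m → Matrix (Fin d) (Fin d) ℂ
  posSemidef : ∀ x, (effect x).PosSemidef
  sum_eq_one : ∑ x, effect x = 1

/-- The joint outcome distribution `p_AB` of the local measurement `M ⊗ N` on `ρ`. -/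
def jointProb {d m n : ℕ} (ρ : BipartiteOp d) (M : Measurement d m) (N : Measurement d n) :
    Fin m × Fin n → ℝ :=
  fun xy => (ρ * (M.effect xy.1 ⊗ₖ N.effect xy.2)).trace.re

/-- The Shannon entropy in bits; the convention `0 log 0 = 0` is automatic. -/
def shannonEntropy {α : Type*} [Fintype α] (p : α → ℝ) : ℝ :=
  -∑ a, p a * Real.logb 2 (p a)

/-- The classical mutual information `H(p_A) + H(p_B) - H(p_AB)` of a joint distribution. -/
def mutualInfo {α β : Type*} [Fintype α] [Fintype β] (p : α × β → ℝ) : ℝ :=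
  shannonEntropy (fun a => ∑ b, p (a, b)) + shannonEntropy (fun b => ∑ a, p (a, b))
    - shannonEntropy p

/-- All values of the classical mutual information obtainable from `ρ` by local measurements. -/
def localMutualInfos {d : ℕ} (ρ : BipartiteOp d) : Set ℝ :=
  {I | ∃ (m n : ℕ) (M : Measurement d m) (N : Measurement d n),
    I = mutualInfo (jointProb ρ M N)}

/-- The classical mutual information `I_c(ρ)` of a bipartite state. -/
def classicalMutualInfo {d : ℕ} (ρ : BipartiteOp d) : ℝ :=
  sSup (localMutualInfos ρ)

end

/-! ### Shannon information of finite distributions -/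

/-! Some finite family of states `Q_x` with weights `w_x` is a weighted 2-design: `∑ w_x Q_x ⊗ Q_x`
is the identity plus the swap. Hence `∑ w_x Tr(A Q_x) Q_x = A + Tr(A) 1`. Applied on both sides of
`X = ρ - ρ_A ⊗ ρ_B`, whose partial traces vanish, this recovers `X` exactly
(`sum_smul_designState_kronecker`).

The effects `w_x Q_x / (d + 1)` form a POVM, and each `Q_x ⊗ Q_y` has trace norm one. So `Tr |X|` is
at most `(d + 1)^2` times the `ℓ¹` distance between the joint outcome distribution and the product
of its marginals. Pinsker's inequality bounds that distance by the mutual information.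

A design mixing phase vectors with the standard basis exists in every dimension, so the constant is
`(d + 1)^2`; both stated bounds follow by monotonicity.

The supremum is finite because `p(x, y) ≤ Tr M_x · Tr N_y`, a product measure whose factors have
total mass `d` (`log_two_mul_mutualInfo_le`). -/

/-- A rational lower bound for the logarithm, with contact of order four at `1`. -/
theorem div_le_log_of_pos {t : ℝ} (ht : 0 < t) :
    (t - 1) * (5 * t + 1) / (2 * t * (t + 2)) ≤ Real.log t := by
  set g : ℝ → ℝ := fun t => Real.log t - (t - 1) * (5 * t + 1) / (2 * t * (t + 2)) with hg
  -- The derivative has the sign of `x - 1`, so `g` has its minimum at `1`, where it vanishes.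
  have hd : ∀ x : ℝ, 0 < x → HasDerivAt g ((x - 1) ^ 3 / (x ^ 2 * (x + 2) ^ 2)) x := by
    intro x hx
    have h1 : HasDerivAt (fun t : ℝ => (t - 1) * (5 * t + 1)) (10 * x - 4) x := by
      have := ((hasDerivAt_id x).sub_const 1).mul (((hasDerivAt_id x).const_mul 5).add_const 1)
      refine this.congr_deriv ?_
      simp only [id]; ring
    have h2 : HasDerivAt (fun t : ℝ => 2 * t * (t + 2)) (4 * x + 4) x := by
      have := ((hasDerivAt_id x).const_mul 2).mul ((hasDerivAt_id x).add_const 2)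
      refine this.congr_deriv ?_
      simp only [id]; ring
    have h3 := (Real.hasDerivAt_log hx.ne').sub (h1.div h2 (by positivity))
    refine h3.congr_deriv ?_
    field_simp
    ring
  have h1 : g 1 = 0 := by simp [hg]
  have hcont : ∀ s : Set ℝ, s ⊆ Set.Ioi 0 → ContinuousOn g s := fun s hs x hx =>
    (hd x (hs hx)).continuousAt.continuousWithinAt
  have key : 0 ≤ g t := by
    rcases le_total 1 t with h | h
    · have hm : MonotoneOn g (Set.Ici 1) := by
        refine monotoneOn_of_deriv_nonneg (convex_Ici 1)
          (hcont _ fun x hx => Set.mem_Ioi.2 (one_pos.trans_le hx)) (fun x hx => ?_) (fun x hx => ?_)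
        all_goals
          rw [interior_Ici] at hx
          have hx1 : (1 : ℝ) < x := hx
          have hx0 : 0 < x := by linarith
        · exact (hd x hx0).differentiableAt.differentiableWithinAt
        · rw [(hd x hx0).deriv]
          have : 0 ≤ x - 1 := by linarith
          positivity
      exact h1 ▸ hm (Set.mem_Ici.2 le_rfl) h h
    · have hm : AntitoneOn g (Set.Icc t 1) := by
        refine antitoneOn_of_deriv_nonpos (convex_Icc t 1)
          (hcont _ fun x hx => lt_of_lt_of_le ht hx.1) (fun x hx => ?_) (fun x hx => ?_)
        all_goals
          rw [interior_Icc] at hx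
          have hx1 : x < 1 := hx.2
          have hx0 : 0 < x := ht.trans hx.1
        · exact (hd x hx0).differentiableAt.differentiableWithinAt
        · rw [(hd x hx0).deriv]
          refine div_nonpos_of_nonpos_of_nonneg ?_ (by positivity)
          have : 0 ≤ (1 - x) ^ 3 := pow_nonneg (by linarith) 3
          nlinarith
      exact h1 ▸ hm (Set.left_mem_Icc.2 h) (Set.right_mem_Icc.2 h) h
  simpa [hg] using key

/-- Pointwise Pinsker, from the logarithm bound at `t = p / q`. The added `- p + q` sums to zero
over distributions, and the weight `2 p + 4 q` sums to `6`. -/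
theorem three_mul_sq_sub_le {p q : ℝ} (hp : 0 ≤ p) (hq : 0 < q) :
    3 * (p - q) ^ 2 ≤ (2 * p + 4 * q) * (p * (Real.log p - Real.log q) - p + q) := by
  rcases hp.eq_or_lt with rfl | hp
  · nlinarith [sq_nonneg q]
  have h := div_le_log_of_pos (div_pos hp hq)
  rw [Real.log_div hp.ne' hq.ne'] at h
  have e : (p / q - 1) * (5 * (p / q) + 1) / (2 * (p / q) * (p / q + 2))
      = (p - q) * (5 * p + q) / (2 * p * (p + 2 * q)) := by
    field_simp
  rw [e, div_le_iff₀ (by positivity)] at h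
  nlinarith

/-- Pinsker's inequality for finite distributions, in nats. -/
theorem sq_sum_abs_sub_le {α : Type*} [Fintype α] {p q : α → ℝ} (hp : ∀ a, 0 ≤ p a)
    (hq : ∀ a, 0 ≤ q a) (hac : ∀ a, q a = 0 → p a = 0) (hp1 : ∑ a, p a = 1)
    (hq1 : ∑ a, q a = 1) :
    (∑ a, |p a - q a|) ^ 2 ≤ 2 * ∑ a, p a * (Real.log (p a) - Real.log (q a)) := by
  have key : ∀ a, 0 ≤ p a * (Real.log (p a) - Real.log (q a)) - p a + q a ∧
      3 * |p a - q a| ^ 2 ≤ (2 * p a + 4 * q a) *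
        (p a * (Real.log (p a) - Real.log (q a)) - p a + q a) := by
    intro a
    rcases (hq a).eq_or_lt with h | h
    · simp [hac a h.symm, ← h]
    · have h3 := three_mul_sq_sub_le (hp a) h
      rw [sq_abs]
      refine ⟨?_, h3⟩
      have h4 : 0 < 2 * p a + 4 * q a := by linarith [hp a]
      exact nonneg_of_mul_nonneg_right (le_trans (by positivity) h3) h4
  -- Cauchy–Schwarz; the first factor sums to `6 / 3 = 2`, the Pinsker constant.
  have h := Finset.sum_sq_le_sum_mul_sum_of_sq_le_mul Finset.univ
    (r := fun a => |p a - q a|) (f := fun a => (2 * p a + 4 * q a) / 3)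
    (g := fun a => p a * (Real.log (p a) - Real.log (q a)) - p a + q a)
    (fun a _ => by have := hp a; have := hq a; positivity) (fun a _ => (key a).1)
    (fun a _ => by have := (key a).2; linarith)
  have e1 : ∑ a, (2 * p a + 4 * q a) / 3 = 2 := by
    rw [← Finset.sum_div, Finset.sum_add_distrib, ← Finset.mul_sum, ← Finset.mul_sum, hp1, hq1]
    norm_num
  have e2 : ∑ a, (p a * (Real.log (p a) - Real.log (q a)) - p a + q a)
      = ∑ a, p a * (Real.log (p a) - Real.log (q a)) := by
    rw [Finset.sum_add_distrib, Finset.sum_sub_distrib, hp1, hq1]; ring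
  rwa [e1, e2] at h

theorem log_two_mul_shannonEntropy {α : Type*} [Fintype α] (p : α → ℝ) :
    Real.log 2 * shannonEntropy p = -∑ a, p a * Real.log (p a) := by
  have h2 : Real.log 2 ≠ 0 := (Real.log_pos one_lt_two).ne'
  rw [shannonEntropy, mul_neg, Finset.mul_sum]
  congr 1
  refine Finset.sum_congr rfl fun a _ => ?_
  rw [Real.logb]; field_simp

theorem log_two_mul_mutualInfo {α β : Type*} [Fintype α] [Fintype β] (p : α × β → ℝ) :
    Real.log 2 * mutualInfo p = ∑ z, p z * (Real.log (p z)
      - Real.log (∑ b, p (z.1, b)) - Real.log (∑ a, p (a, z.2))) := by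
  rw [mutualInfo, mul_sub, mul_add, log_two_mul_shannonEntropy, log_two_mul_shannonEntropy,
    log_two_mul_shannonEntropy]
  simp only [mul_sub, Finset.sum_sub_distrib]
  have eA : ∑ z, p z * Real.log (∑ b, p (z.1, b))
      = ∑ a, (∑ b, p (a, b)) * Real.log (∑ b, p (a, b)) := by
    simp [Fintype.sum_prod_type, Finset.sum_mul]
  have eB : ∑ z, p z * Real.log (∑ a, p (a, z.2))
      = ∑ b, (∑ a, p (a, b)) * Real.log (∑ a, p (a, b)) := by
    simp [Fintype.sum_prod_type_right, Finset.sum_mul]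
  rw [eA, eB]; ring

/-- Pinsker's inequality for the mutual information in bits. -/
theorem sum_abs_sub_mul_le_sqrt_mutualInfo {α β : Type*} [Fintype α] [Fintype β]
    {p : α × β → ℝ} (hp : ∀ z, 0 ≤ p z) (hp1 : ∑ z, p z = 1) :
    ∑ z, |p z - (∑ b, p (z.1, b)) * ∑ a, p (a, z.2)|
      ≤ √(2 * Real.log 2 * mutualInfo p) := by
  refine Real.le_sqrt_of_sq_le ?_
  have hA : ∀ z : α × β, (∑ b, p (z.1, b)) = 0 → p z = 0 := fun z h =>
    (Finset.sum_eq_zero_iff_of_nonneg fun b _ => hp (z.1, b)).1 h z.2 (Finset.mem_univ _)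
  have hB : ∀ z : α × β, (∑ a, p (a, z.2)) = 0 → p z = 0 := fun z h =>
    (Finset.sum_eq_zero_iff_of_nonneg fun a _ => hp (a, z.2)).1 h z.1 (Finset.mem_univ _)
  have h := sq_sum_abs_sub_le (p := p)
    (q := fun z => (∑ b, p (z.1, b)) * ∑ a, p (a, z.2)) hp
    (fun z => mul_nonneg (Finset.sum_nonneg fun b _ => hp _) (Finset.sum_nonneg fun b _ => hp _))
    (fun z hz => (mul_eq_zero.1 hz).elim (hA z) (hB z)) hp1
    (by
      rw [Fintype.sum_prod_type]
      simp only
      rw [← Finset.sum_mul_sum, ← Fintype.sum_prod_type, ← Fintype.sum_prod_type_right, hp1,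
        one_mul])
  rw [mul_assoc, log_two_mul_mutualInfo]
  refine h.trans_eq ?_
  congr 1
  refine Finset.sum_congr rfl fun z _ => ?_
  by_cases hz : p z = 0
  · simp [hz]
  · rw [Real.log_mul (fun h => hz (hA z h)) (fun h => hz (hB z h))]; ring

theorem mul_log_sub_log_le {p m : ℝ} (hp : 0 ≤ p) (hm : 0 ≤ m) (hac : m = 0 → p = 0) :
    p * (Real.log m - Real.log p) ≤ m - p := by
  rcases hp.eq_or_lt with rfl | hp
  · simpa
  have hm' : 0 < m := hm.lt_of_ne fun h => hp.ne' (hac h.symm)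
  have h := Real.log_le_sub_one_of_pos (div_pos hm' hp)
  rw [Real.log_div hm'.ne' hp.ne'] at h
  calc p * (Real.log m - Real.log p) ≤ p * (m / p - 1) := by gcongr
    _ = m - p := by field_simp

/-- A joint distribution dominated by a product measure has bounded mutual information. -/
theorem log_two_mul_mutualInfo_le {α β : Type*} [Fintype α] [Fintype β] {p : α × β → ℝ}
    {m : α → ℝ} {n : β → ℝ} (hp : ∀ z, 0 ≤ p z) (hp1 : ∑ z, p z = 1) (hm : ∀ a, 0 ≤ m a)
    (hn : ∀ b, 0 ≤ n b) (hle : ∀ z, p z ≤ m z.1 * n z.2) :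
    Real.log 2 * mutualInfo p ≤ ∑ a, m a + ∑ b, n b - 2 := by
  rw [log_two_mul_mutualInfo]
  have hpt : ∀ z, p z * (Real.log (p z) - Real.log (∑ b, p (z.1, b))
      - Real.log (∑ a, p (a, z.2))) ≤
      p z * (Real.log (m z.1) - Real.log (∑ b, p (z.1, b)))
        + p z * (Real.log (n z.2) - Real.log (∑ a, p (a, z.2))) := by
    -- Domination gives `log p ≤ log m + log n`, which splits the sum into two relative-entropy
    -- terms, one per marginal.
    intro z
    rcases (hp z).eq_or_lt with h | h
    · simp [← h]
    have hpos := h.trans_le (hle z)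
    have hm0 : m z.1 ≠ 0 := fun h => by simp [h] at hpos
    have hn0 : n z.2 ≠ 0 := fun h => by simp [h] at hpos
    have hl := Real.log_le_log h (hle z)
    rw [Real.log_mul hm0 hn0] at hl
    rw [← mul_add]
    exact mul_le_mul_of_nonneg_left (by linarith) h.le
  refine (Finset.sum_le_sum fun z _ => hpt z).trans ?_
  rw [Finset.sum_add_distrib]
  have eA : ∑ z, p z * (Real.log (m z.1) - Real.log (∑ b, p (z.1, b)))
      = ∑ a, (∑ b, p (a, b)) * (Real.log (m a) - Real.log (∑ b, p (a, b))) := by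
    simp [Fintype.sum_prod_type, Finset.sum_mul]
  have eB : ∑ z, p z * (Real.log (n z.2) - Real.log (∑ a, p (a, z.2)))
      = ∑ b, (∑ a, p (a, b)) * (Real.log (n b) - Real.log (∑ a, p (a, b))) := by
    simp [Fintype.sum_prod_type_right, Finset.sum_mul]
  have hA : ∑ a, (∑ b, p (a, b)) * (Real.log (m a) - Real.log (∑ b, p (a, b)))
      ≤ ∑ a, (m a - ∑ b, p (a, b)) := Finset.sum_le_sum fun a _ =>
    mul_log_sub_log_le (Finset.sum_nonneg fun b _ => hp _) (hm a) fun h =>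
      Finset.sum_eq_zero fun b _ => le_antisymm (by simpa [h] using hle (a, b)) (hp _)
  have hB : ∑ b, (∑ a, p (a, b)) * (Real.log (n b) - Real.log (∑ a, p (a, b)))
      ≤ ∑ b, (n b - ∑ a, p (a, b)) := Finset.sum_le_sum fun b _ =>
    mul_log_sub_log_le (Finset.sum_nonneg fun b _ => hp _) (hn b) fun h =>
      Finset.sum_eq_zero fun a _ => le_antisymm (by simpa [h] using hle (a, b)) (hp _)
  rw [Finset.sum_sub_distrib, ← Fintype.sum_prod_type, hp1] at hA
  rw [Finset.sum_sub_distrib, ← Fintype.sum_prod_type_right, hp1] at hB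
  rw [eA, eB]
  linarith

theorem mutualInfo_eq_zero_of_eq_mul {α β : Type*} [Fintype α] [Fintype β] {f : α → ℝ}
    {g : β → ℝ} (hf : ∑ a, f a = 1) (hg : ∑ b, g b = 1) :
    mutualInfo (fun z : α × β => f z.1 * g z.2) = 0 := by
  have h2 : Real.log 2 ≠ 0 := (Real.log_pos one_lt_two).ne'
  refine (mul_eq_zero.1 ((log_two_mul_mutualInfo _).trans ?_)).resolve_left h2
  refine Finset.sum_eq_zero fun z _ => ?_
  simp only [← Finset.mul_sum, ← Finset.sum_mul, hf, hg, mul_one, one_mul]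
  by_cases h : f z.1 * g z.2 = 0
  · simp [h]
  · rw [Real.log_mul (left_ne_zero_of_mul h) (right_ne_zero_of_mul h)]; ring

/-! ### Traces of products and the trace norm -/

section TraceNorm

variable {ι : Type*} [Fintype ι] [DecidableEq ι]

theorem Matrix.IsHermitian.trace_mul_eq_sum_eigenvalues {A : Matrix ι ι ℂ} (hA : A.IsHermitian)
    (B : Matrix ι ι ℂ) :
    (A * B).trace = ∑ i, (hA.eigenvalues i : ℂ) *
      ((hA.eigenvectorUnitary : Matrix ι ι ℂ)ᴴ * B * (hA.eigenvectorUnitary : Matrix ι ι ℂ)) i i := by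
  conv_lhs => rw [hA.spectral_theorem]
  rw [Unitary.conjStarAlgAut_apply, mul_assoc, mul_assoc, trace_mul_comm, mul_assoc, trace]
  simp only [diag_apply, diagonal_mul, Function.comp_apply]
  rfl

theorem Matrix.trace_conj_unitary (U : unitary (Matrix ι ι ℂ)) (B : Matrix ι ι ℂ) :
    ((U : Matrix ι ι ℂ)ᴴ * B * (U : Matrix ι ι ℂ)).trace = B.trace := by
  rw [trace_mul_cycle, ← star_eq_conjTranspose, Unitary.mul_star_self_of_mem U.2, one_mul]

theorem Matrix.PosSemidef.trace_mul_nonneg {A B : Matrix ι ι ℂ} (hA : A.PosSemidef)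
    (hB : B.PosSemidef) : 0 ≤ (A * B).trace := by
  rw [hA.1.trace_mul_eq_sum_eigenvalues]
  refine Finset.sum_nonneg fun i _ => mul_nonneg ?_ (hB.conjTranspose_mul_mul_same _).diag_nonneg
  exact_mod_cast hA.eigenvalues_nonneg i

/-- In an eigenbasis of `A`, each diagonal entry of `B` is at most `Tr B`. -/
theorem Matrix.PosSemidef.trace_mul_le {A B : Matrix ι ι ℂ} (hA : A.PosSemidef)
    (hB : B.PosSemidef) : (A * B).trace ≤ A.trace * B.trace := by
  rw [hA.1.trace_mul_eq_sum_eigenvalues, hA.1.trace_eq_sum_eigenvalues, Finset.sum_mul]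
  refine Finset.sum_le_sum fun i _ => mul_le_mul_of_nonneg_left ?_ ?_
  · rw [← trace_conj_unitary hA.1.eigenvectorUnitary B]
    exact Finset.single_le_sum
      (f := fun i => ((hA.1.eigenvectorUnitary : Matrix ι ι ℂ)ᴴ * B *
        (hA.1.eigenvectorUnitary : Matrix ι ι ℂ)) i i)
      (fun j _ => (hB.conjTranspose_mul_mul_same _).diag_nonneg) (Finset.mem_univ i)
  · exact_mod_cast hA.eigenvalues_nonneg i

theorem traceNorm_eq_sum_abs_eigenvalues {X : Matrix ι ι ℂ} (hX : X.IsHermitian) :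
    traceNorm X = ∑ i, |hX.eigenvalues i| := by
  rw [traceNorm, CFC.abs_eq_cfc_norm X hX, hX.cfc_eq, IsHermitian.cfc,
    Unitary.conjStarAlgAut_apply, trace_mul_cycle, Unitary.coe_star_mul_self, one_mul,
    trace_diagonal]
  simp

/-- In an eigenbasis of `X`, the diagonal of `Y` dominates the absolute eigenvalues. This does the
work of the triangle inequality in `traceNorm_sum_smul_le`. -/
theorem traceNorm_le_re_trace {X Y : Matrix ι ι ℂ} (hX : X.IsHermitian)
    (h₁ : (Y - X).PosSemidef) (h₂ : (Y + X).PosSemidef) : traceNorm X ≤ Y.trace.re := by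
  rw [traceNorm_eq_sum_abs_eigenvalues hX, ← trace_conj_unitary hX.eigenvectorUnitary Y, trace,
    Complex.re_sum]
  set U : Matrix ι ι ℂ := (hX.eigenvectorUnitary : Matrix ι ι ℂ)
  have hd : Uᴴ * X * U = diagonal (fun i => (hX.eigenvalues i : ℂ)) := by
    have := hX.conjStarAlgAut_star_eigenvectorUnitary
    rw [Unitary.conjStarAlgAut_star_apply] at this
    exact this
  refine Finset.sum_le_sum fun i _ => ?_
  have e₁ := (h₁.conjTranspose_mul_mul_same U).diag_nonneg (i := i)
  have e₂ := (h₂.conjTranspose_mul_mul_same U).diag_nonneg (i := i)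
  rw [mul_sub, sub_mul, hd, Matrix.sub_apply, diagonal_apply_eq, Complex.le_def] at e₁
  rw [mul_add, add_mul, hd, Matrix.add_apply, diagonal_apply_eq, Complex.le_def] at e₂
  have f₁ := e₁.1
  have f₂ := e₂.1
  simp only [Complex.zero_re, Complex.sub_re, Complex.add_re, Complex.ofReal_re] at f₁ f₂
  rw [diag_apply, abs_le]
  constructor <;> linarith

theorem eq_zero_of_traceNorm_nonpos {X : Matrix ι ι ℂ} (hX : X.IsHermitian)
    (h : traceNorm X ≤ 0) : X = 0 := by
  rw [traceNorm_eq_sum_abs_eigenvalues hX] at h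
  rw [← hX.eigenvalues_eq_zero_iff]
  funext i
  have h0 := le_antisymm h (Finset.sum_nonneg fun i _ => abs_nonneg _)
  exact abs_eq_zero.1 ((Finset.sum_eq_zero_iff_of_nonneg fun i _ => abs_nonneg _).1 h0 i
    (Finset.mem_univ i))

theorem traceNorm_sum_smul_le {κ : Type*} [Fintype κ] {Q : κ → Matrix ι ι ℂ}
    (hQ : ∀ z, IsState (Q z)) (c : κ → ℝ) :
    traceNorm (∑ z, (c z : ℂ) • Q z) ≤ ∑ z, |c z| := by
  have hpos : ∀ a : κ → ℝ, (∀ z, 0 ≤ a z) → (∑ z, (a z : ℂ) • Q z).PosSemidef := fun a ha =>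
    posSemidef_sum _ fun z _ => (hQ z).1.smul (by exact_mod_cast ha z)
  have hherm : (∑ z, (c z : ℂ) • Q z).IsHermitian := by
    rw [IsHermitian, conjTranspose_sum]
    refine Finset.sum_congr rfl fun z _ => ?_
    rw [conjTranspose_smul, (hQ z).1.1.eq]
    simp
  refine (traceNorm_le_re_trace (Y := ∑ z, ((|c z| : ℝ) : ℂ) • Q z) hherm ?_ ?_).trans_eq ?_
  · convert hpos (fun z => |c z| - c z) (fun z => sub_nonneg.2 (le_abs_self _)) using 1
    simp only [Complex.ofReal_sub, sub_smul, Finset.sum_sub_distrib]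
  · convert hpos (fun z => |c z| + c z) (fun z => by linarith [neg_abs_le (c z)]) using 1
    simp only [Complex.ofReal_add, add_smul, Finset.sum_add_distrib]
  · rw [trace_sum, Complex.re_sum]
    refine Finset.sum_congr rfl fun z _ => ?_
    rw [trace_smul, (hQ z).2, smul_eq_mul, mul_one, Complex.ofReal_re]

end TraceNorm

/-! ### Reduced states and local measurements -/

section Bipartite

variable {d : ℕ}

theorem IsState.kronecker {ι κ : Type*} [Fintype ι] [Fintype κ] {A : Matrix ι ι ℂ}
    {B : Matrix κ κ ℂ} (hA : IsState A) (hB : IsState B) : IsState (A ⊗ₖ B) :=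
  ⟨hA.1.kronecker hB.1, by rw [trace_kronecker, hA.2, hB.2, one_mul]⟩

theorem trace_mul_kronecker_one (ρ : BipartiteOp d) (A : Matrix (Fin d) (Fin d) ℂ) :
    (ρ * (A ⊗ₖ 1)).trace = (reducedA ρ * A).trace := by
  simp only [trace, diag_apply, mul_apply, reducedA, of_apply, kroneckerMap_apply, one_apply,
    Fintype.sum_prod_type, Finset.sum_mul, mul_ite, mul_one, mul_zero, Finset.sum_ite_eq',
    Finset.mem_univ, if_true]
  exact Finset.sum_congr rfl fun i _ => Finset.sum_comm

theorem trace_mul_one_kronecker (ρ : BipartiteOp d) (B : Matrix (Fin d) (Fin d) ℂ) :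
    (ρ * (1 ⊗ₖ B)).trace = (reducedB ρ * B).trace := by
  simp only [trace, diag_apply, mul_apply, reducedB, of_apply, kroneckerMap_apply, one_apply,
    Fintype.sum_prod_type, Finset.sum_mul, mul_ite, ite_mul, one_mul, zero_mul, mul_zero]
  calc _ = ∑ i, ∑ j, ∑ k, ρ (i, j) (i, k) * B k j := by
        refine Finset.sum_congr rfl fun i _ => Finset.sum_congr rfl fun j _ => ?_
        rw [Finset.sum_comm]
        exact Finset.sum_congr rfl fun k _ => by
          rw [Finset.sum_ite_eq' Finset.univ i, if_pos (Finset.mem_univ i)]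
    _ = _ := by
        rw [Finset.sum_comm]
        exact Finset.sum_congr rfl fun j _ => Finset.sum_comm

theorem IsState.reducedA {ρ : BipartiteOp d} (hρ : IsState ρ) : IsState (reducedA ρ) := by
  constructor
  · have : _root_.reducedA ρ = ∑ k, ρ.submatrix (fun i => (i, k)) (fun i => (i, k)) := by
      ext i j; simp [_root_.reducedA, Matrix.sum_apply]
    rw [this]
    exact posSemidef_sum _ fun k _ => hρ.1.submatrix _
  · rw [← hρ.2, ← mul_one (_root_.reducedA ρ), ← trace_mul_kronecker_one, one_kronecker_one, mul_one]

theorem IsState.reducedB {ρ : BipartiteOp d} (hρ : IsState ρ) : IsState (reducedB ρ) := by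
  constructor
  · have : _root_.reducedB ρ = ∑ k, ρ.submatrix (fun i => (k, i)) (fun i => (k, i)) := by
      ext i j; simp [_root_.reducedB, Matrix.sum_apply]
    rw [this]
    exact posSemidef_sum _ fun k _ => hρ.1.submatrix _
  · rw [← hρ.2, ← mul_one (_root_.reducedB ρ), ← trace_mul_one_kronecker, one_kronecker_one, mul_one]

theorem reducedA_sub_kronecker_eq_zero {ρ : BipartiteOp d} (hρ : IsState ρ) :
    reducedA (ρ - reducedA ρ ⊗ₖ reducedB ρ) = 0 := by
  ext i j
  have h : ∑ k, _root_.reducedB ρ k k = 1 := hρ.reducedB.2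
  rw [_root_.reducedA]
  simp only [of_apply, Matrix.sub_apply, kroneckerMap_apply, Finset.sum_sub_distrib,
    ← Finset.mul_sum, h, mul_one, Matrix.zero_apply]
  exact sub_self _

theorem reducedB_sub_kronecker_eq_zero {ρ : BipartiteOp d} (hρ : IsState ρ) :
    reducedB (ρ - reducedA ρ ⊗ₖ reducedB ρ) = 0 := by
  ext i j
  have h : ∑ k, _root_.reducedA ρ k k = 1 := hρ.reducedA.2
  rw [_root_.reducedB]
  simp only [of_apply, Matrix.sub_apply, kroneckerMap_apply, Finset.sum_sub_distrib,
    ← Finset.sum_mul, h, one_mul, Matrix.zero_apply]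
  exact sub_self _

variable {m n : ℕ} (M : Measurement d m) (N : Measurement d n)

theorem jointProb_nonneg {ρ : BipartiteOp d} (hρ : ρ.PosSemidef) (z : Fin m × Fin n) :
    0 ≤ jointProb ρ M N z :=
  (Complex.le_def.1 (hρ.trace_mul_nonneg
    ((M.posSemidef z.1).kronecker (N.posSemidef z.2)))).1

theorem sum_jointProb_right (ρ : BipartiteOp d) (x : Fin m) :
    ∑ y, jointProb ρ M N (x, y) = (reducedA ρ * M.effect x).trace.re := by
  rw [← trace_mul_kronecker_one, ← N.sum_eq_one]
  simp only [jointProb]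
  rw [← Complex.re_sum, ← trace_sum, ← Finset.mul_sum]
  congr 3
  ext i j
  simp [Matrix.sum_apply, Finset.mul_sum]

theorem sum_jointProb_left (ρ : BipartiteOp d) (y : Fin n) :
    ∑ x, jointProb ρ M N (x, y) = (reducedB ρ * N.effect y).trace.re := by
  rw [← trace_mul_one_kronecker, ← M.sum_eq_one]
  simp only [jointProb]
  rw [← Complex.re_sum, ← trace_sum, ← Finset.mul_sum]
  congr 3
  ext i j
  simp [Matrix.sum_apply, Finset.sum_mul]

theorem sum_trace_mul_effect (A : Matrix (Fin d) (Fin d) ℂ) :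
    ∑ x, (A * M.effect x).trace.re = A.trace.re := by
  rw [← Complex.re_sum, ← trace_sum, ← Finset.mul_sum, M.sum_eq_one, mul_one]

theorem sum_jointProb {ρ : BipartiteOp d} (hρ : IsState ρ) : ∑ z, jointProb ρ M N z = 1 := by
  rw [Fintype.sum_prod_type]
  simp only [sum_jointProb_right]
  rw [sum_trace_mul_effect, hρ.reducedA.2, Complex.one_re]

theorem jointProb_kronecker {σ τ : Matrix (Fin d) (Fin d) ℂ} (hσ : σ.PosSemidef)
    (z : Fin m × Fin n) :
    jointProb (σ ⊗ₖ τ) M N z =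
      (σ * M.effect z.1).trace.re * (τ * N.effect z.2).trace.re := by
  -- The first factor is real, so the real part of the product is the product of real parts.
  have h := (Complex.le_def.1 (hσ.trace_mul_nonneg (M.posSemidef z.1))).2
  rw [jointProb, ← mul_kronecker_mul, trace_kronecker, Complex.mul_re, ← h]
  simp

theorem jointProb_le {ρ : BipartiteOp d} (hρ : IsState ρ) (z : Fin m × Fin n) :
    jointProb ρ M N z ≤ (M.effect z.1).trace.re * (N.effect z.2).trace.re := by
  have h := (Complex.le_def.1 (hρ.1.trace_mul_le
    ((M.posSemidef z.1).kronecker (N.posSemidef z.2)))).1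
  have h' := (Complex.le_def.1 (M.posSemidef z.1).trace_nonneg).2
  rw [hρ.2, one_mul, trace_kronecker, Complex.mul_re, ← h'] at h
  simpa [jointProb] using h

theorem jointProb_sub_mul {ρ : BipartiteOp d} (hρ : IsState ρ) (z : Fin m × Fin n) :
    jointProb ρ M N z - (∑ y, jointProb ρ M N (z.1, y)) * ∑ x, jointProb ρ M N (x, z.2)
      = ((ρ - reducedA ρ ⊗ₖ reducedB ρ) * (M.effect z.1 ⊗ₖ N.effect z.2)).trace.re := by
  rw [sum_jointProb_right, sum_jointProb_left, ← jointProb_kronecker M N hρ.reducedA.1 z, sub_mul,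
    trace_sub, Complex.sub_re]
  rfl

/-- The one-outcome measurement. -/
def Measurement.trivial (d : ℕ) : Measurement d 1 where
  effect _ := 1
  posSemidef _ := .one
  sum_eq_one := by simp

theorem localMutualInfos_nonempty (ρ : BipartiteOp d) : (localMutualInfos ρ).Nonempty :=
  ⟨_, 1, 1, .trivial d, .trivial d, rfl⟩

theorem bddAbove_localMutualInfos {ρ : BipartiteOp d} (hρ : IsState ρ) :
    BddAbove (localMutualInfos ρ) := by
  refine ⟨(d + d - 2) / Real.log 2, ?_⟩
  rintro _ ⟨m, n, M, N, rfl⟩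
  rw [le_div_iff₀ (Real.log_pos one_lt_two), mul_comm]
  have hsum : ∀ {k : ℕ} (K : Measurement d k), ∑ x, (K.effect x).trace.re = d := by
    intro k K
    have := sum_trace_mul_effect K 1
    simpa using this
  have h := log_two_mul_mutualInfo_le (jointProb_nonneg M N hρ.1) (sum_jointProb M N hρ)
    (m := fun x => (M.effect x).trace.re) (n := fun y => (N.effect y).trace.re)
    (fun x => (Complex.le_def.1 (M.posSemidef x).trace_nonneg).1)
    (fun y => (Complex.le_def.1 (N.posSemidef y).trace_nonneg).1) (jointProb_le M N hρ)
  rwa [hsum, hsum] at h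

theorem localMutualInfos_eq_of_isProductState {ρ : BipartiteOp d} (hρ : IsProductState ρ) :
    localMutualInfos ρ = {0} := by
  refine (localMutualInfos_nonempty ρ).subset_singleton_iff.1 ?_
  rintro _ ⟨m, n, M, N, rfl⟩
  obtain ⟨σ, τ, hσ, hτ, rfl⟩ := hρ
  rw [funext (jointProb_kronecker M N hσ.1)]
  exact mutualInfo_eq_zero_of_eq_mul
    (f := fun x => (σ * M.effect x).trace.re) (g := fun y => (τ * N.effect y).trace.re)
    (by rw [sum_trace_mul_effect, hσ.2, Complex.one_re])
    (by rw [sum_trace_mul_effect, hτ.2, Complex.one_re])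

end Bipartite

/-! ### A weighted complex projective 2-design -/

section Design

variable {d : ℕ}

/-- Orthogonality of characters: the sum survives only when the exponent vanishes identically. Cube
roots are needed since signs would also let `i = k`, `j = l` survive. -/
theorem sum_stdAddChar_pi (i j k l : Fin d) :
    ∑ ε : Fin d → ZMod 3, ZMod.stdAddChar (ε i - ε j + ε k - ε l)
      = if (i = j ∧ k = l) ∨ (i = l ∧ k = j) then (3 : ℂ) ^ d else 0 := by
  let f : (Fin d → ZMod 3) →+ ZMod 3 := Pi.evalAddMonoidHom (fun _ => ZMod 3) i - Pi.evalAddMonoidHom (fun _ => ZMod 3) j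
    + Pi.evalAddMonoidHom (fun _ => ZMod 3) k - Pi.evalAddMonoidHom (fun _ => ZMod 3) l
  have hf : ∀ ε, f ε = ε i - ε j + ε k - ε l := fun ε => rfl
  let ψ : AddChar (Fin d → ZMod 3) ℂ := ZMod.stdAddChar.compAddMonoidHom f
  have hψ : ψ = 0 ↔ (i = j ∧ k = l) ∨ (i = l ∧ k = j) := by
    constructor
    · intro h
      have h0 : ∀ ε : Fin d → ZMod 3, ε i - ε j + ε k - ε l = 0 := fun ε => by
        rw [← hf]
        -- Faithfulness of the standard character turns triviality of `ψ` into a linear identity,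
        -- which is then tested on unit vectors.
        refine ZMod.injective_stdAddChar ?_
        rw [AddChar.map_zero_eq_one]
        exact DFunLike.congr_fun h ε
      have hi := h0 (Pi.single i 1)
      have hk := h0 (Pi.single k 1)
      simp only [Pi.single_apply] at hi hk
      split_ifs at hi hk <;>
        first
        | exact absurd hi (by decide)
        | exact absurd hk (by decide)
        | grind
    · rintro (⟨rfl, rfl⟩ | ⟨rfl, rfl⟩) <;> ext ε <;> simp [ψ, hf]
  classical
  have h := AddChar.sum_eq_ite ψ
  simp only [hψ] at h
  simpa [ψ, hf] using h

/-- The rank-one projections onto the vectors with entries `χ (ε a) / √d`, `ε : Fin d → ZMod 3`,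
and onto the standard basis vectors. -/
noncomputable def designState (d : ℕ) : (Fin d → ZMod 3) ⊕ Fin d → Matrix (Fin d) (Fin d) ℂ
  | .inl ε => (d : ℂ)⁻¹ • vecMulVec (fun a => (ZMod.stdAddChar (ε a) : ℂ))
      (star fun a => (ZMod.stdAddChar (ε a) : ℂ))
  | .inr i => Matrix.single i i 1

/-- The weights that make `designState` a 2-design. -/
noncomputable def designWeight (d : ℕ) : (Fin d → ZMod 3) ⊕ Fin d → ℝ
  | .inl _ => d ^ 2 / 3 ^ d
  | .inr _ => 1

theorem designState_inl_apply (ε : Fin d → ZMod 3) (a b : Fin d) :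
    designState d (.inl ε) a b = (d : ℂ)⁻¹ * ZMod.stdAddChar (ε a - ε b) := by
  simp [designState, vecMulVec_apply, sub_eq_add_neg, AddChar.map_add_eq_mul,
    AddChar.map_neg_eq_conj]

theorem designState_inr_apply (t a b : Fin d) :
    designState d (.inr t) a b = if t = a ∧ t = b then 1 else 0 := by
  simp [designState, single_apply]

theorem isState_designState (hd : d ≠ 0) (x : (Fin d → ZMod 3) ⊕ Fin d) :
    IsState (designState d x) := by
  have hd' : (d : ℂ) ≠ 0 := by exact_mod_cast hd
  rcases x with ε | i
  · refine ⟨(posSemidef_vecMulVec_self_star _).smul (by positivity), ?_⟩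
    simp [trace, designState_inl_apply, hd']
  · refine ⟨?_, by simp [designState]⟩
    have : designState d (.inr i) = vecMulVec (Pi.single i 1) (star (Pi.single i 1)) := by
      ext a b
      rw [designState_inr_apply, vecMulVec_apply]
      simp [Pi.single_apply, eq_comm, ← ite_and, and_comm]
    rw [this]
    exact posSemidef_vecMulVec_self_star _

theorem designWeight_nonneg (x : (Fin d → ZMod 3) ⊕ Fin d) : 0 ≤ designWeight d x := by
  rcases x with ε | i <;> simp only [designWeight] <;> positivity

/-- The phase vectors give identity plus swap, except that `i = j = k = l` is counted once instead
of twice; the basis vectors supply the missing term. -/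
theorem sum_designWeight_mul (hd : d ≠ 0) (i j k l : Fin d) :
    ∑ x, (designWeight d x : ℂ) * (designState d x i j * designState d x k l)
      = (if i = j then 1 else 0) * (if k = l then 1 else 0)
        + (if i = l then 1 else 0) * (if k = j then 1 else 0) := by
  have hd' : (d : ℂ) ≠ 0 := by exact_mod_cast hd
  have h1 : ∑ ε : Fin d → ZMod 3, (designWeight d (.inl ε) : ℂ) *
      (designState d (.inl ε) i j * designState d (.inl ε) k l)
      = if (i = j ∧ k = l) ∨ (i = l ∧ k = j) then 1 else 0 := by
    have : ∀ ε : Fin d → ZMod 3, (designWeight d (.inl ε) : ℂ) *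
        (designState d (.inl ε) i j * designState d (.inl ε) k l)
        = ((3 : ℂ) ^ d)⁻¹ * ZMod.stdAddChar (ε i - ε j + ε k - ε l) := by
      intro ε
      rw [designState_inl_apply, designState_inl_apply, add_sub_assoc, AddChar.map_add_eq_mul]
      simp only [designWeight]
      push_cast
      field_simp
    simp only [this, ← Finset.mul_sum, sum_stdAddChar_pi]
    split_ifs <;> simp
  have h2 : ∑ t : Fin d, (designWeight d (.inr t) : ℂ) *
      (designState d (.inr t) i j * designState d (.inr t) k l)
      = if i = j ∧ k = l ∧ i = k then 1 else 0 := by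
    simp only [designState_inr_apply, designWeight, Complex.ofReal_one, ← ite_and, mul_ite,
      mul_one, mul_zero]
    by_cases h : i = j ∧ k = l ∧ i = k
    · obtain ⟨rfl, rfl, rfl⟩ := h
      simp
    · rw [if_neg h]
      refine Finset.sum_eq_zero fun t _ => if_neg ?_
      rintro ⟨⟨rfl, rfl⟩, rfl, rfl⟩
      exact h ⟨rfl, rfl, rfl⟩
  rw [Fintype.sum_sum_type, h1, h2]
  by_cases e1 : i = j <;> by_cases e2 : k = l <;> by_cases e3 : i = l <;> by_cases e4 : k = j <;>
    simp_all

end Design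

/-! ### Reconstruction from the 2-design and the trace-norm bound -/

section Reconstruction

variable {d : ℕ}

/-- A state 2-design reconstructs operators with vanishing partial traces. -/
theorem sum_smul_designState_kronecker (hd : d ≠ 0) {X : BipartiteOp d} (hA : reducedA X = 0)
    (hB : reducedB X = 0) :
    ∑ z : ((Fin d → ZMod 3) ⊕ Fin d) × ((Fin d → ZMod 3) ⊕ Fin d),
      ((designWeight d z.1 : ℂ) * designWeight d z.2 *
        (X * (designState d z.1 ⊗ₖ designState d z.2)).trace) •
          (designState d z.1 ⊗ₖ designState d z.2) = X := by
  have hA' : ∀ i j, ∑ k, X (i, k) (j, k) = 0 := fun i j => congr_fun₂ hA i j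
  have hB' : ∀ i j, ∑ k, X (k, i) (k, j) = 0 := fun i j => congr_fun₂ hB i j
  ext ⟨i, j⟩ ⟨k, l⟩
  -- Of the four products on the right, three contract a pair of indices of `X` into a partial trace
  -- and vanish on summation; swap times swap returns the entry of `X`.
  have key : ∀ s t : Fin d × Fin d,
      ∑ z : ((Fin d → ZMod 3) ⊕ Fin d) × ((Fin d → ZMod 3) ⊕ Fin d),
        (designWeight d z.1 : ℂ) * designWeight d z.2 *
          (X s t * (designState d z.1 t.1 s.1 * designState d z.2 t.2 s.2)) *
          (designState d z.1 i k * designState d z.2 j l)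
      = X s t * (((if t.1 = s.1 then 1 else 0) * (if i = k then 1 else 0)
        + (if t.1 = k then 1 else 0) * (if i = s.1 then 1 else 0)) *
        ((if t.2 = s.2 then 1 else 0) * (if j = l then 1 else 0)
        + (if t.2 = l then 1 else 0) * (if j = s.2 then 1 else 0))) := by
    intro s t
    rw [← sum_designWeight_mul hd, ← sum_designWeight_mul hd, Fintype.sum_mul_sum,
      ← Fintype.sum_prod_type', Finset.mul_sum]
    exact Finset.sum_congr rfl fun z _ => by ring
  calc _ = ∑ s, ∑ t, ∑ z : ((Fin d → ZMod 3) ⊕ Fin d) × ((Fin d → ZMod 3) ⊕ Fin d),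
        (designWeight d z.1 : ℂ) * designWeight d z.2 *
          (X s t * (designState d z.1 t.1 s.1 * designState d z.2 t.2 s.2)) *
          (designState d z.1 i k * designState d z.2 j l) := by
        rw [Matrix.sum_apply]
        simp only [Matrix.smul_apply, smul_eq_mul, kroneckerMap_apply, trace, diag_apply,
          mul_apply, Finset.mul_sum, Finset.sum_mul]
        rw [Finset.sum_comm]
        exact Finset.sum_congr rfl fun s _ => Finset.sum_comm
    _ = X (i, j) (k, l) := by
        simp only [key]
        simp only [Fintype.sum_prod_type, mul_add, add_mul, Finset.sum_add_distrib]
        by_cases h₁ : i = k <;> by_cases h₂ : j = l <;>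
          simp [Finset.sum_ite_irrel, h₁, h₂, hA', hB']

/-- The measurement formed by the weighted states of a 2-design. -/
noncomputable def designMeasurement (hd : d ≠ 0) :
    Measurement d (Fintype.card ((Fin d → ZMod 3) ⊕ Fin d)) where
  effect x := ((designWeight d ((Fintype.equivFin _).symm x) / (d + 1) : ℝ) : ℂ) •
    designState d ((Fintype.equivFin _).symm x)
  posSemidef x := (isState_designState hd _).1.smul (by
    have := designWeight_nonneg ((Fintype.equivFin ((Fin d → ZMod 3) ⊕ Fin d)).symm x)
    exact_mod_cast (by positivity))
  sum_eq_one := by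
    have hd' : (d : ℂ) + 1 ≠ 0 := by exact_mod_cast d.succ_ne_zero
    rw [Equiv.sum_comp (Fintype.equivFin ((Fin d → ZMod 3) ⊕ Fin d)).symm
      (fun x => ((designWeight d x / (d + 1) : ℝ) : ℂ) • designState d x)]
    ext i j
    -- Contracting `k = l` in the design identity gives `d` from the identity and `1` from the swap.
    have h : ∑ x, (designWeight d x : ℂ) * designState d x i j
        = ((d : ℂ) + 1) * if i = j then 1 else 0 := by
      calc _ = ∑ x, ∑ k, (designWeight d x : ℂ) * (designState d x i j * designState d x k k) := by
            refine Finset.sum_congr rfl fun x _ => ?_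
            have h1 : ∑ k, designState d x k k = 1 := (isState_designState hd x).2
            rw [← Finset.mul_sum, ← Finset.mul_sum, h1, mul_one]
        _ = _ := by
            rw [Finset.sum_comm]
            simp only [sum_designWeight_mul hd]
            rw [Finset.sum_add_distrib]
            by_cases hij : i = j <;> simp [hij]
    rw [Matrix.sum_apply, one_apply]
    calc _ = (∑ x, (designWeight d x : ℂ) * designState d x i j) / (d + 1) := by
          rw [Finset.sum_div]
          refine Finset.sum_congr rfl fun x _ => ?_
          rw [Matrix.smul_apply, smul_eq_mul]
          push_cast
          ring
      _ = _ := by rw [h, mul_div_cancel_left₀ _ hd']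

/-- The factor `(d + 1)^2` undoes the normalisation of the two POVMs. -/
theorem traceNorm_le_sum_abs_designMeasurement (hd : d ≠ 0) {X : BipartiteOp d}
    (hX : X.IsHermitian) (hA : reducedA X = 0) (hB : reducedB X = 0) :
    traceNorm X ≤ ((d : ℝ) + 1) ^ 2 * ∑ z : Fin _ × Fin _,
      |(X * ((designMeasurement hd).effect z.1 ⊗ₖ (designMeasurement hd).effect z.2)).trace.re| := by
  have hreal : ∀ z : ((Fin d → ZMod 3) ⊕ Fin d) × ((Fin d → ZMod 3) ⊕ Fin d),
      (((X * (designState d z.1 ⊗ₖ designState d z.2)).trace.re : ℝ) : ℂ)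
        = (X * (designState d z.1 ⊗ₖ designState d z.2)).trace := by
    intro z
    refine Complex.conj_eq_iff_re.1 ?_
    have hQ := ((isState_designState hd z.1).kronecker (isState_designState hd z.2)).1.1
    rw [starRingEnd_apply, ← trace_conjTranspose, conjTranspose_mul, hX.eq, hQ.eq, trace_mul_comm]
  have h := traceNorm_sum_smul_le
    (fun z : ((Fin d → ZMod 3) ⊕ Fin d) × ((Fin d → ZMod 3) ⊕ Fin d) =>
      (isState_designState hd z.1).kronecker (isState_designState hd z.2))
    (fun z => designWeight d z.1 * designWeight d z.2 *
      (X * (designState d z.1 ⊗ₖ designState d z.2)).trace.re)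
  simp only [Complex.ofReal_mul, hreal] at h
  rw [sum_smul_designState_kronecker hd hA hB] at h
  refine h.trans_eq ?_
  rw [← Equiv.sum_comp ((Fintype.equivFin ((Fin d → ZMod 3) ⊕ Fin d)).symm.prodCongr
    (Fintype.equivFin ((Fin d → ZMod 3) ⊕ Fin d)).symm), Finset.mul_sum]
  refine Finset.sum_congr rfl fun z _ => ?_
  have hd' : (0 : ℝ) < d + 1 := by positivity
  have e : ∀ (a b : ℝ) (P Q : Matrix (Fin d) (Fin d) ℂ),
      (X * ((((a / (d + 1) : ℝ) : ℂ) • P) ⊗ₖ (((b / (d + 1) : ℝ) : ℂ) • Q))).trace.re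
        = (a * b * (X * (P ⊗ₖ Q)).trace.re) / ((d : ℝ) + 1) ^ 2 := by
    intro a b P Q
    rw [smul_kronecker, kronecker_smul, Matrix.mul_smul, Matrix.mul_smul, trace_smul, trace_smul,
      smul_eq_mul, smul_eq_mul, Complex.re_ofReal_mul, Complex.re_ofReal_mul]
    field_simp
  simp only [designMeasurement, e, Equiv.prodCongr_apply, Prod.map]
  rw [abs_div, abs_of_pos (pow_pos hd' 2), mul_div_cancel₀ _ (pow_pos hd' 2).ne']

theorem traceNorm_sub_kronecker_le {ρ : BipartiteOp d} (hρ : IsState ρ) :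
    traceNorm (ρ - reducedA ρ ⊗ₖ reducedB ρ) ≤
      ((d : ℝ) + 1) ^ 2 * √(2 * Real.log 2 * classicalMutualInfo ρ) := by
  have hd : d ≠ 0 := by
    rintro rfl
    simpa [trace] using hρ.2
  have hherm : (ρ - reducedA ρ ⊗ₖ reducedB ρ).IsHermitian :=
    hρ.1.1.sub (hρ.reducedA.kronecker hρ.reducedB).1.1
  refine (traceNorm_le_sum_abs_designMeasurement hd hherm (reducedA_sub_kronecker_eq_zero hρ)
    (reducedB_sub_kronecker_eq_zero hρ)).trans ?_
  simp only [← jointProb_sub_mul _ _ hρ]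
  gcongr
  refine (sum_abs_sub_mul_le_sqrt_mutualInfo (jointProb_nonneg _ _ hρ.1)
    (sum_jointProb _ _ hρ)).trans (Real.sqrt_le_sqrt ?_)
  have h2 := Real.log_pos one_lt_two
  gcongr
  exact le_csSup (bddAbove_localMutualInfos hρ) ⟨_, _, _, _, rfl⟩

end Reconstruction

/-! ### Prime powers and the final statement -/

theorem exists_isLeast_isPrimePow_lt {d : ℕ} (hd : d ≠ 0) :
    ∃ q : ℕ, IsLeast {q : ℕ | d ≤ q ∧ (q = 1 ∨ IsPrimePow q)} q ∧ q < 2 * d := by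
  have h : ∃ q, (d ≤ q ∧ (q = 1 ∨ IsPrimePow q)) ∧ q < 2 * d := by
    -- The least power of two above `d` is below `2 d`. For `d = 1` it is `1`, which `IsPrimePow`
    -- excludes.
    rcases Nat.lt_or_ge 1 d with h1 | h1
    · refine ⟨2 ^ Nat.clog 2 d, ⟨Nat.le_pow_clog one_lt_two d, Or.inr ?_⟩, ?_⟩
      · exact Nat.prime_two.isPrimePow.pow (Nat.clog_pos one_lt_two h1).ne'
      · have h2 := Nat.pow_pred_clog_lt_self one_lt_two h1
        have h3 := Nat.clog_pos one_lt_two h1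
        obtain ⟨k, hk⟩ := Nat.exists_eq_succ_of_ne_zero h3.ne'
        rw [hk] at h2 ⊢
        rw [pow_succ]
        simp only [Nat.pred_succ] at h2
        omega
    · exact ⟨1, ⟨h1, Or.inl rfl⟩, by omega⟩
  classical
  have h' : ∃ q, d ≤ q ∧ (q = 1 ∨ IsPrimePow q) := h.imp fun q hq => hq.1
  obtain ⟨q, hq, hlt⟩ := h
  exact ⟨Nat.find h', ⟨Nat.find_spec h', fun r hr => Nat.find_min' h' hr⟩,
    (Nat.find_min' h' hq).trans_lt hlt⟩

theorem lemma1 (d : ℕ) (ρ : BipartiteOp d) (hρ : IsState ρ) :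
    -- the supremum defining `I_c` is a genuine one
    IsLUB (localMutualInfos ρ) (classicalMutualInfo ρ) ∧
    -- the bound with the least prime power `d' ≥ d` (where `1 = p ^ 0` counts), and `d' < 2 d`
    (∃ d' : ℕ, IsLeast {q : ℕ | d ≤ q ∧ (q = 1 ∨ IsPrimePow q)} d' ∧ d' < 2 * d ∧
      traceNorm (ρ - reducedA ρ ⊗ₖ reducedB ρ) ≤
        ((d' : ℝ) + 1) ^ 2 * √(2 * Real.log 2 * classicalMutualInfo ρ)) ∧
    -- the bound with `(2 d) ^ 2`
    traceNorm (ρ - reducedA ρ ⊗ₖ reducedB ρ) ≤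
      (2 * (d : ℝ)) ^ 2 * √(2 * Real.log 2 * classicalMutualInfo ρ) ∧
    (classicalMutualInfo ρ = 0 ↔ IsProductState ρ) := by
  -- An empty matrix has trace `0`, not `1`.
  have hd : d ≠ 0 := by
    rintro rfl
    simpa [trace] using hρ.2
  have hbound := traceNorm_sub_kronecker_le hρ
  refine ⟨isLUB_csSup (localMutualInfos_nonempty ρ) (bddAbove_localMutualInfos hρ), ?_, ?_, ?_⟩
  · obtain ⟨q, hq, hlt⟩ := exists_isLeast_isPrimePow_lt hd
    have hle : (d : ℝ) ≤ q := by exact_mod_cast hq.1.1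
    exact ⟨q, hq, hlt, hbound.trans (by gcongr)⟩
  · have h1 : (1 : ℝ) ≤ d := by exact_mod_cast Nat.one_le_iff_ne_zero.2 hd
    refine hbound.trans ?_
    gcongr
    linarith
  · constructor
    -- The bound forces `ρ = ρ_A ⊗ ρ_B`, so the reduced states are the witnesses.
    · intro h
      rw [h, mul_zero, Real.sqrt_zero, mul_zero] at hbound
      exact ⟨_, _, hρ.reducedA, hρ.reducedB, sub_eq_zero.1 (eq_zero_of_traceNorm_nonpos
        (hρ.1.1.sub (hρ.reducedA.kronecker hρ.reducedB).1.1) hbound)⟩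
    · intro h
      rw [classicalMutualInfo, localMutualInfos_eq_of_isProductState h, csSup_singleton]
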